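/- **Setting.** Let $\mathbb{F}_q$ be a finite field and $L\ge 1$. All entropies $H$ and mutual informations $I$ are in base $q$. Two messages $W_1,W_2$ are independent and uniform on $\mathbb{F}_q^L$. Four servers store $S_n=\Psi_n(W_1,W_2,Z)\in\mathbb{F}_q^{a_n}$, $n\in[4]$, where $Z$ is random noise with finite alphabet, independent of $(W_1,W_2)$, and the encoding functions $\Psi_n$ are arbitrary. To retrieve $W_\kappa$, $\kappa\in\{1,2\}$, the user sends to server $n$ a query $Q_n^{[\kappa]}$ with finite alphabet, and server $n$ returns $A_n^{[\kappa]}=\varphi_n(S_n,Q_n^{[\kappa]})\in\mathbb{F}_q^{b_n}$, where the function $\varphi_n$ does not depend on $\kappa$. The index $\Theta\in\{1,2\}$ of the wanted message is random, takes both values with positive probability, and is independent of $Q_{[4]}^{[\kappa]}=(Q_1^{[\kappa]},\dots,Q_4^{[\kappa]})$ for each $\kappa$. Let $\{i,j,k,\ell\}=\{1,2,3,4\}$; servers $i,j$ communicate and servers $k,\ell$ communicate. The scheme has to satisfy: * (no prior information) $I(W_1,W_2,S_1,\dots,S_4;\,Q_{[4]}^{[\kappa]})=0$ for $\kappa=1,2$;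 * (privacy, no collusion) $I(\Theta;\,Q_n^{[\Theta]})=0$ for every $n\in[4]$; * (security) $I(W_1,W_2;S_n)=0$ for every $n$, $I(W_1,W_2;S_i,S_j)=0$ and $I(W_1,W_2;S_k,S_\ell)=0$; * (decodability) $H(W_\kappa\mid A_1^{[\kappa]},\dots,A_4^{[\kappa]},Q_{[4]}^{[\kappa]})=0$ for $\kappa=1,2$. The average storage is $\alpha=\frac{1}{8L}\sum_{n=1}^4 H(S_n)$. The average download cost is $\beta=\frac{1}{4R}$ with rate $R=L\big/\sum_{n=1}^4 H(A_n^{[\kappa]})$, that is, $\beta=\frac1{4L}\sum_{n=1}^4 H(A_n^{[\kappa]})$, for either $\kappa$. Let $\mathcal{R}$ be the set of all pairs $(\alpha,\beta)$ obtained in this way, over all $q$, $L$ and all schemes. **Theorem.** Every $(\alpha,\beta)\in\mathcal{R}$ satisfies $$\beta\ge\tfrac34,\qquad \alpha+2\beta\ge 2,\qquad \alpha+6\beta\ge 3 .$$ -/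

import Mathlib

universe u

open MeasureTheory

noncomputable section

namespace AXPIR

section Information

variable {Ω : Type*} [MeasurableSpace Ω] {α β : Type*} [Fintype α] [Fintype β]

/-- Shannon entropy, in base `b`, of a random variable with values in a finite alphabet. -/
def entropy (μ : Measure Ω) (b : ℝ) (X : Ω → α) : ℝ :=
  (∑ x, Real.negMulLog (μ.real (X ⁻¹' {x}))) / Real.log b

/-- Conditional entropy `H(X | Y) = H(X, Y) - H(Y)`. -/
def condEntropy (μ : Measure Ω) (b : ℝ) (X : Ω → α) (Y : Ω → β) : ℝ :=
  entropy μ b (fun ω => (X ω, Y ω)) - entropy μ b Y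

/-- Mutual information `I(X ; Y) = H(X) + H(Y) - H(X, Y)`. -/
def mutualInfo (μ : Measure Ω) (b : ℝ) (X : Ω → α) (Y : Ω → β) : ℝ :=
  entropy μ b X + entropy μ b Y - entropy μ b (fun ω => (X ω, Y ω))

end Information

/-- The objects of a storage and retrieval system with `N` servers and `K` messages. The
requirements of security, privacy and so on are imposed separately below. -/
structure Scheme (N K : ℕ) where
  /-- The finite field of symbols. -/
  F : Type u
  [fieldF : Field F]
  [fintypeF : Fintype F]
  /-- The message length, in symbols. -/
  L : ℕ
  L_pos : 0 < L
  Ω : Type u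
  [measurableSpaceΩ : MeasurableSpace Ω]
  μ : Measure Ω
  [isProbabilityMeasureμ : IsProbabilityMeasure μ]
  /-- The messages. -/
  W : Ω → Fin K → Fin L → F
  W_measurable : Measurable[measurableSpaceΩ, ⊤] W
  /-- The messages are independent and uniform on `F ^ L`. -/
  W_uniform : ∀ w : Fin K → Fin L → F, μ.real (W ⁻¹' {w}) = 1 / (Fintype.card F : ℝ) ^ (K * L)
  /-- The alphabet of the random noise used by the storage code. -/
  Noise : Type u
  [fintypeNoise : Fintype Noise]
  Z : Ω → Noise
  Z_measurable : Measurable[measurableSpaceΩ, ⊤] Z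
  /-- The noise is independent of the messages. -/
  Z_indep : mutualInfo μ (Fintype.card F) W Z = 0
  /-- Number of symbols that server `n` can hold. -/
  storageLen : Fin N → ℕ
  /-- The encoding function of server `n`, applied to the messages and the noise. -/
  Ψ : (n : Fin N) → (Fin K → Fin L → F) → Noise → Fin (storageLen n) → F
  /-- The alphabet of the queries to server `n`. -/
  Query : Fin N → Type u
  [fintypeQuery : ∀ n, Fintype (Query n)]
  /-- `Q k ω n` is the query to server `n` when message `k` is wanted. -/
  Q : Fin K → Ω → (n : Fin N) → Query n
  Q_measurable : ∀ k, Measurable[measurableSpaceΩ, ⊤] (Q k)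
  /-- The index of the wanted message. -/
  Θ : Ω → Fin K
  Θ_measurable : Measurable[measurableSpaceΩ, ⊤] Θ
  /-- Every message may be wanted. -/
  Θ_pos : ∀ k, 0 < μ.real (Θ ⁻¹' {k})
  /-- `Θ` is independent of the queries prepared for each fixed message `k`; only the choice
  among them depends on `Θ`. -/
  Θ_indep : ∀ k, mutualInfo μ (Fintype.card F) Θ (Q k) = 0
  /-- Number of symbols in an answer of server `n`. -/
  answerLen : Fin N → ℕ
  /-- The answering function of server `n`: it sees its storage and its query only, in
  particular not the index of the wanted message. -/
  φ : (n : Fin N) → (Fin (storageLen n) → F) → Query n → Fin (answerLen n) → F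

attribute [instance] Scheme.fieldF Scheme.fintypeF Scheme.measurableSpaceΩ
  Scheme.isProbabilityMeasureμ Scheme.fintypeNoise Scheme.fintypeQuery

namespace Scheme

variable {N K : ℕ} (s : Scheme.{u} N K)

/-- The field size as a real number. All information quantities are in base `q`, that is, they
are measured in symbols of the field. -/
def q : ℝ := Fintype.card s.F

/-- The storage of server `n`. -/
def S (n : Fin N) (ω : s.Ω) : Fin (s.storageLen n) → s.F := s.Ψ n (s.W ω) (s.Z ω)

/-- The answer of server `n` when message `k` is wanted. -/
def A (k : Fin K) (n : Fin N) (ω : s.Ω) : Fin (s.answerLen n) → s.F := s.φ n (s.S n ω) (s.Q k ω n)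

/-- `I(W_[K], S_[N] ; Q_[N]^[k]) = 0`: the user makes the queries without knowing anything about
the messages or the stored contents. -/
def NoPriorInfo : Prop :=
  ∀ k, mutualInfo s.μ s.q (fun ω => (s.W ω, fun n => s.S n ω)) (s.Q k) = 0

/-- `I(Θ ; Q_n^[Θ]) = 0`: no single server learns anything about the wanted index. -/
def IsPrivate : Prop :=
  ∀ n, mutualInfo s.μ s.q s.Θ (fun ω => s.Q (s.Θ ω) ω n) = 0

/-- Neither a single server nor the servers of one communication link together learn anything
about the messages from what they store. -/
def IsSecure {M : ℕ} (X : Fin M → Finset (Fin N)) : Prop :=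
  (∀ n, mutualInfo s.μ s.q s.W (s.S n) = 0) ∧
    ∀ m, mutualInfo s.μ s.q s.W (fun ω (n : X m) => s.S n ω) = 0

/-- `H(W_k | A_[N]^[k], Q_[N]^[k]) = 0`: the user recovers the wanted message. -/
def IsDecodable : Prop :=
  ∀ k, condEntropy s.μ s.q (fun ω => s.W ω k) (fun ω => (fun n => s.A k n ω, s.Q k ω)) = 0

/-- The average storage `α = (∑ n, H(S_n)) / (N K L)`. -/
def avgStorage : ℝ := (∑ n, entropy s.μ s.q (s.S n)) / (N * K * s.L)

/-- The retrieval rate: message length over total download, when message `k` is wanted. -/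
def rate (k : Fin K) : ℝ := s.L / ∑ n, entropy s.μ s.q (s.A k n)

/-- The average download cost `β = 1 / (N R)`. -/
def avgDownload (k : Fin K) : ℝ := 1 / (N * s.rate k)

end Scheme

/-- The region of the pairs `(α, β)` attained with `N` servers, `K` messages and communication
links `X` (the columns of the communication matrix). -/
def region (N K : ℕ) {M : ℕ} (X : Fin M → Finset (Fin N)) : Set (ℝ × ℝ) :=
  {p | ∃ (s : Scheme.{u} N K) (k : Fin K), s.NoPriorInfo ∧ s.IsPrivate ∧ s.IsSecure X ∧
    s.IsDecodable ∧ p = (s.avgStorage, s.avgDownload k)}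

end AXPIR

end

/-!
Let `C` be the servers of one link and `D` the others, and give the retriever the contents of `C`
and the messages in a set `U` as side information. By security and the absence of prior
information, a message `k ∉ U` still has `L` symbols of entropy, and the answers of `D` now reveal
it, so they carry `L` symbols more given `U` than given `U ∪ {k}`. To descend further, switch to
another wanted message `k'`: the answer of a single server depends on its own query only, whose law
is the same for `k` and `k'` by privacy, so the joint entropy of the answers of `D` changes by a
factor of at most `#D`. Hence the servers of `D` return at least `L (1 + 1/#D + ⋯ + 1/#D ^ (K - 1))`
symbols; and they store at least `K L` symbols, since the contents of all servers determine all
messages while those of `C` reveal nothing. Averaging over the links gives the region.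

All variables are functions of an outcome in a finite sample space, where entropy inequalities are
instances of the nonnegativity of relative entropy.
-/

noncomputable section

open scoped Finset

namespace AXPIR

section RelativeEntropy

open InformationTheory

variable {α : Type*} [Fintype α] {a b : α → ℝ}

lemma sum_mul_klFun_div (hab : ∀ x, b x = 0 → a x = 0) :
    ∑ x, b x * klFun (a x / b x) =
      ∑ x, a x * (Real.log (a x) - Real.log (b x)) + (∑ x, b x - ∑ x, a x) := by
  rw [← Finset.sum_sub_distrib, ← Finset.sum_add_distrib]
  refine Finset.sum_congr rfl fun x _ => ?_
  by_cases hb : b x = 0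
  · simp [hb, hab x hb]
  by_cases ha : a x = 0
  · simp [ha, klFun]
  rw [klFun, Real.log_div ha hb]
  field_simp
  ring

lemma sum_mul_log_sub_log_nonneg (ha : ∀ x, 0 ≤ a x) (hb : ∀ x, 0 ≤ b x)
    (hab : ∀ x, b x = 0 → a x = 0) (h : ∑ x, b x ≤ ∑ x, a x) :
    0 ≤ ∑ x, a x * (Real.log (a x) - Real.log (b x)) := by
  have hkl : 0 ≤ ∑ x, b x * klFun (a x / b x) := Finset.sum_nonneg fun x _ =>
    mul_nonneg (hb x) (klFun_nonneg (div_nonneg (ha x) (hb x)))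
  rw [sum_mul_klFun_div hab] at hkl
  linarith

lemma eq_of_sum_mul_log_sub_log_eq_zero (ha : ∀ x, 0 ≤ a x) (hb : ∀ x, 0 ≤ b x)
    (hab : ∀ x, b x = 0 → a x = 0) (h : ∑ x, b x ≤ ∑ x, a x)
    (h0 : ∑ x, a x * (Real.log (a x) - Real.log (b x)) = 0) : a = b := by
  have hterm : ∀ x ∈ Finset.univ, 0 ≤ b x * klFun (a x / b x) := fun x _ =>
    mul_nonneg (hb x) (klFun_nonneg (div_nonneg (ha x) (hb x)))
  have hkl : ∑ x, b x * klFun (a x / b x) = 0 := by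
    refine le_antisymm ?_ (Finset.sum_nonneg hterm)
    rw [sum_mul_klFun_div hab]
    linarith
  funext x
  by_cases hbx : b x = 0
  · rw [hbx, hab x hbx]
  · have := (mul_eq_zero.1 ((Finset.sum_eq_zero_iff_of_nonneg hterm).1 hkl x
      (Finset.mem_univ x))).resolve_left hbx
    rwa [klFun_eq_zero_iff (div_nonneg (ha x) (hb x)), div_eq_one_iff_eq hbx] at this

end RelativeEntropy

section FiniteEntropy

variable {T : Type*} [Fintype T] {p : T → ℝ} {α β γ δ : Type*}

/-- The law, as a mass function on the alphabet, of a random variable `f` on a finite sample space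
with mass function `p`. -/
def law (p : T → ℝ) (f : T → α) (x : α) : ℝ :=
  ∑ t, (f ⁻¹' {x}).indicator p t

/-- Entropy, in nats, of a random variable `f` on a finite sample space with mass function `p`. It
is written as an average over the sample space, so that the alphabet of `f` can be any type. -/
def ent (p : T → ℝ) (f : T → α) : ℝ :=
  -∑ t, p t * Real.log (law p f (f t))

/-- Conditional entropy `H(X | Y)`, in nats, on a finite sample space. -/
def condEnt (p : T → ℝ) (X : T → α) (Y : T → β) : ℝ :=
  ent p (fun t => (X t, Y t)) - ent p Y

/-- Independence of `X` and `Y`, expressed as additivity of entropy. -/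
def EntIndep (p : T → ℝ) (X : T → α) (Y : T → β) : Prop :=
  ent p (fun t => (X t, Y t)) = ent p X + ent p Y

/-- The mass function under which `X` and `Y` are conditionally independent given `Z` while
`(X, Z)` and `(Y, Z)` keep their laws. -/
def condProd (p : T → ℝ) (X : T → α) (Y : T → β) (Z : T → γ) (w : (α × β) × γ) : ℝ :=
  law p (fun t => (X t, Z t)) (w.1.1, w.2) * law p (fun t => (Y t, Z t)) (w.1.2, w.2) / law p Z w.2

lemma law_nonneg (hp : ∀ t, 0 ≤ p t) (f : T → α) (x : α) : 0 ≤ law p f x :=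
  Finset.sum_nonneg fun t _ => Set.indicator_nonneg (fun t _ => hp t) t

lemma le_law (hp : ∀ t, 0 ≤ p t) (f : T → α) (t : T) : p t ≤ law p f (f t) := by
  have h := Finset.single_le_sum (f := (f ⁻¹' {f t}).indicator p)
    (fun u _ => Set.indicator_nonneg (fun u _ => hp u) u) (Finset.mem_univ t)
  rwa [Set.indicator_of_mem (by simp)] at h

lemma law_mono (hp : ∀ t, 0 ≤ p t) {f : T → α} {g : T → β} {x : α} {y : β}
    (h : f ⁻¹' {x} ⊆ g ⁻¹' {y}) : law p f x ≤ law p g y :=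
  Finset.sum_le_sum fun t _ => Set.indicator_le_indicator_of_subset h hp t

lemma law_congr {f : T → α} {g : T → β} {x : α} {y : β} (h : f ⁻¹' {x} = g ⁻¹' {y}) :
    law p f x = law p g y := by
  rw [law, law, h]

lemma sum_law_mul [Fintype α] (f : T → α) (F : α → ℝ) :
    ∑ x, law p f x * F x = ∑ t, p t * F (f t) := by
  classical
  simp only [law, Finset.sum_mul]
  rw [Finset.sum_comm]
  simp [Set.indicator_apply]

lemma sum_law [Fintype α] (f : T → α) : ∑ x, law p f x = ∑ t, p t := by
  simpa using sum_law_mul (p := p) f fun _ => 1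

lemma sum_law_prod [Fintype α] (X : T → α) (Z : T → γ) (z : γ) :
    ∑ x, law p (fun t => (X t, Z t)) (x, z) = law p Z z := by
  classical
  simp only [law]
  rw [Finset.sum_comm]
  simp [Set.indicator_apply, ite_and]

lemma law_law [Fintype α] (f : T → α) (g : α → β) : law (law p f) g = law p (g ∘ f) := by
  classical
  funext y
  simpa [law, Set.indicator_apply] using sum_law_mul (p := p) f fun x => if g x = y then 1 else 0

lemma ent_law [Fintype α] (f : T → α) (g : α → β) : ent (law p f) g = ent p (g ∘ f) := by
  rw [ent, sum_law_mul f fun x => Real.log (law (law p f) g (g x)), law_law]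
  rfl

lemma ent_comp_congr [Finite α] {f f' : T → α} (h : law p f = law p f') (g : α → β) :
    ent p (g ∘ f) = ent p (g ∘ f') := by
  cases nonempty_fintype α
  rw [← ent_law, h, ent_law]

lemma ent_eq_sum_negMulLog [Fintype α] (f : T → α) :
    ent p f = ∑ x, Real.negMulLog (law p f x) := by
  rw [ent, ← sum_law_mul f fun x => Real.log (law p f x)]
  simp [Real.negMulLog]

lemma ent_mono (hp : ∀ t, 0 ≤ p t) {f : T → α} {g : T → β} (h : g.FactorsThrough f) :
    ent p g ≤ ent p f := by
  refine neg_le_neg (Finset.sum_le_sum fun t _ => ?_)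
  rcases (hp t).eq_or_lt with h0 | h0
  · simp [← h0]
  · exact mul_le_mul_of_nonneg_left (Real.log_le_log (h0.trans_le (le_law hp f t))
      (law_mono hp fun u hu => h hu)) (hp t)

lemma ent_congr (hp : ∀ t, 0 ≤ p t) {f : T → α} {g : T → β}
    (h : ∀ t u, f t = f u ↔ g t = g u) : ent p f = ent p g :=
  le_antisymm (ent_mono hp fun t u => (h t u).2) (ent_mono hp fun t u => (h t u).1)

lemma ent_of_subsingleton [Subsingleton α] (h1 : ∑ t, p t = 1) (f : T → α) : ent p f = 0 := by
  have hlaw : ∀ t, law p f (f t) = 1 := fun t => by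
    simp [law, h1, Subsingleton.elim _ (f t)]
  simp [ent, hlaw]

lemma ent_le_log_card [Fintype α] (hp : ∀ t, 0 ≤ p t) (h1 : ∑ t, p t = 1) (f : T → α) :
    ent p f ≤ Real.log (Fintype.card α) := by
  obtain ⟨t, -⟩ : ∃ t ∈ Finset.univ, p t ≠ 0 := Finset.exists_ne_zero_of_sum_ne_zero (by simp [h1])
  have : Nonempty α := ⟨f t⟩
  have hcard : (Fintype.card α : ℝ) ≠ 0 := by simp
  have h := sum_mul_log_sub_log_nonneg (b := fun _ => (Fintype.card α : ℝ)⁻¹) (law_nonneg hp f)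
    (fun _ => by positivity) (fun _ hx => absurd hx (inv_ne_zero hcard))
    (by simp [sum_law, h1])
  simp only [mul_sub, Finset.sum_sub_distrib, ← Finset.sum_mul, sum_law, h1, Real.log_inv] at h
  simp only [ent_eq_sum_negMulLog, Real.negMulLog, neg_mul, Finset.sum_neg_distrib]
  linarith

lemma ent_of_uniform [Fintype α] {f : T → α} (hf : ∀ x, law p f x = (Fintype.card α : ℝ)⁻¹) :
    ent p f = Real.log (Fintype.card α) := by
  rcases isEmpty_or_nonempty α with h | h
  · simp [ent_eq_sum_negMulLog]
  · simp [ent_eq_sum_negMulLog, hf, Real.negMulLog]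

lemma condProd_nonneg (hp : ∀ t, 0 ≤ p t) (X : T → α) (Y : T → β) (Z : T → γ)
    (w : (α × β) × γ) : 0 ≤ condProd p X Y Z w :=
  div_nonneg (mul_nonneg (law_nonneg hp _ _) (law_nonneg hp _ _)) (law_nonneg hp _ _)

lemma law_eq_zero_of_condProd_eq_zero (hp : ∀ t, 0 ≤ p t) {X : T → α} {Y : T → β} {Z : T → γ}
    {w : (α × β) × γ} (h : condProd p X Y Z w = 0) :
    law p (fun t => ((X t, Y t), Z t)) w = 0 := by
  refine le_antisymm ?_ (law_nonneg hp _ _)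
  rcases div_eq_zero_iff.1 h with h | h
  · rcases mul_eq_zero.1 h with h | h <;> refine h ▸ law_mono hp ?_ <;> rintro t rfl <;> rfl
  · refine h ▸ law_mono hp ?_
    rintro t rfl
    rfl

lemma sum_condProd [Fintype α] [Fintype β] [Fintype γ] (X : T → α) (Y : T → β) (Z : T → γ) :
    ∑ w, condProd p X Y Z w = ∑ t, p t := by
  calc ∑ w, condProd p X Y Z w
      = ∑ z, (∑ x, law p (fun t => (X t, Z t)) (x, z)) *
          (∑ y, law p (fun t => (Y t, Z t)) (y, z)) / law p Z z := by
        rw [Fintype.sum_prod_type_right]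
        simp only [Fintype.sum_prod_type, condProd, Finset.sum_mul_sum, Finset.sum_div]
    _ = ∑ t, p t := by simp only [sum_law_prod, mul_self_div_self, sum_law]

lemma sum_law_mul_log_sub_log_condProd [Fintype α] [Fintype β] [Fintype γ] (hp : ∀ t, 0 ≤ p t)
    (X : T → α) (Y : T → β) (Z : T → γ) :
    ∑ w, law p (fun t => ((X t, Y t), Z t)) w *
        (Real.log (law p (fun t => ((X t, Y t), Z t)) w) - Real.log (condProd p X Y Z w)) =
      condEnt p X Z + condEnt p Y Z - condEnt p (fun t => (X t, Y t)) Z := by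
  have hterm : ∀ t, p t * (Real.log (law p (fun t => ((X t, Y t), Z t)) ((X t, Y t), Z t)) -
        Real.log (condProd p X Y Z ((X t, Y t), Z t))) =
      p t * Real.log (law p (fun t => ((X t, Y t), Z t)) ((X t, Y t), Z t)) -
        p t * Real.log (law p (fun t => (X t, Z t)) (X t, Z t)) -
        p t * Real.log (law p (fun t => (Y t, Z t)) (Y t, Z t)) +
        p t * Real.log (law p Z (Z t)) := by
    intro t
    rcases (hp t).eq_or_lt with h0 | h0
    · simp [← h0]
    · have hXZ := (h0.trans_le (le_law hp (fun t => (X t, Z t)) t)).ne'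
      have hYZ := (h0.trans_le (le_law hp (fun t => (Y t, Z t)) t)).ne'
      have hZ := (h0.trans_le (le_law hp Z t)).ne'
      rw [condProd, Real.log_div (mul_ne_zero hXZ hYZ) hZ, Real.log_mul hXZ hYZ]
      ring
  rw [sum_law_mul _ fun w => Real.log (law p (fun t => ((X t, Y t), Z t)) w) -
    Real.log (condProd p X Y Z w), Finset.sum_congr rfl fun t _ => hterm t]
  simp only [Finset.sum_add_distrib, Finset.sum_sub_distrib, condEnt, ent]
  ring

lemma condEnt_congr (hp : ∀ t, 0 ≤ p t) {X : T → α} {Y : T → β} {X' : T → γ} {Y' : T → δ}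
    (hX : ∀ t u, X t = X u ↔ X' t = X' u) (hY : ∀ t u, Y t = Y u ↔ Y' t = Y' u) :
    condEnt p X Y = condEnt p X' Y' := by
  rw [condEnt, condEnt, ent_congr hp hY, ent_congr hp]
  intro t u
  simp only [Prod.mk.injEq, hX, hY]

lemma condEnt_of_subsingleton [Subsingleton β] (hp : ∀ t, 0 ≤ p t) (h1 : ∑ t, p t = 1)
    (X : T → α) (Y : T → β) : condEnt p X Y = ent p X := by
  rw [condEnt, ent_of_subsingleton h1 Y, sub_zero]
  exact ent_congr hp fun t u => by rw [Prod.mk.injEq, and_iff_left (Subsingleton.elim _ _)]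

/-- Nonnegativity of the conditional mutual information `I(X ; Y | Z)`. -/
lemma condEnt_prod_le (hp : ∀ t, 0 ≤ p t) (X : T → α) (Y : T → β) (Z : T → γ) :
    condEnt p (fun t => (X t, Y t)) Z ≤ condEnt p X Z + condEnt p Y Z := by
  let finX := Fintype.ofFinite (Set.range X)
  let finY := Fintype.ofFinite (Set.range Y)
  let finZ := Fintype.ofFinite (Set.range Z)
  let X' := Set.rangeFactorization X
  let Y' := Set.rangeFactorization Y
  let Z' := Set.rangeFactorization Z
  have hX : ∀ t u, X' t = X' u ↔ X t = X u := fun t u => Subtype.ext_iff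
  have hY : ∀ t u, Y' t = Y' u ↔ Y t = Y u := fun t u => Subtype.ext_iff
  have hZ : ∀ t u, Z' t = Z' u ↔ Z t = Z u := fun t u => Subtype.ext_iff
  have h := sum_mul_log_sub_log_nonneg (law_nonneg hp fun t => ((X' t, Y' t), Z' t))
    (condProd_nonneg hp X' Y' Z') (fun w => law_eq_zero_of_condProd_eq_zero hp)
    (by rw [sum_condProd, sum_law])
  rw [sum_law_mul_log_sub_log_condProd hp, condEnt_congr hp hX hZ, condEnt_congr hp hY hZ,
    condEnt_congr hp (X' := fun t => (X t, Y t)) (by simp [hX, hY]) hZ] at h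
  linarith

lemma condEnt_nonneg (hp : ∀ t, 0 ≤ p t) (X : T → α) (Y : T → β) : 0 ≤ condEnt p X Y :=
  sub_nonneg.2 (ent_mono hp fun _ _ h => congrArg Prod.snd h)

lemma condEnt_mono_left (hp : ∀ t, 0 ≤ p t) {X : T → α} {X' : T → β} (h : X.FactorsThrough X')
    (Y : T → γ) : condEnt p X Y ≤ condEnt p X' Y :=
  sub_le_sub_right (ent_mono hp fun t u htu => by
    rw [Prod.mk.injEq] at htu
    rw [h htu.1, htu.2]) _

lemma condEnt_prod (hp : ∀ t, 0 ≤ p t) (X : T → α) (Y : T → β) (Z : T → γ) :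
    condEnt p (fun t => (X t, Y t)) Z =
      condEnt p X (fun t => (Y t, Z t)) + condEnt p Y Z := by
  rw [condEnt, condEnt, condEnt, ent_congr hp (g := fun t => (X t, Y t, Z t)) (by simp [and_assoc])]
  ring

lemma condEnt_anti_right (hp : ∀ t, 0 ≤ p t) (X : T → α) {Y : T → β} {Y' : T → γ}
    (h : Y.FactorsThrough Y') : condEnt p X Y' ≤ condEnt p X Y := by
  have hle := condEnt_prod_le hp X Y' Y
  rw [condEnt_prod hp] at hle
  rw [condEnt_congr hp (Y' := fun t => (Y' t, Y t)) (fun _ _ => Iff.rfl) fun t u => by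
    simp only [Prod.mk.injEq]
    exact ⟨fun e => ⟨e, h e⟩, And.left⟩]
  linarith

lemma condEnt_le_ent (hp : ∀ t, 0 ≤ p t) (h1 : ∑ t, p t = 1) (X : T → α) (Y : T → β) :
    condEnt p X Y ≤ ent p X := by
  refine (condEnt_anti_right hp X (Y := fun _ => ()) fun _ _ _ => rfl).trans_eq ?_
  exact condEnt_of_subsingleton hp h1 X _

lemma condEnt_restrict_le_sum {ι : Type*} {π : ι → Type*} (hp : ∀ t, 0 ≤ p t) (C : Finset ι)
    (X : T → ∀ i, π i) (Y : T → β) :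
    condEnt p (fun t => C.restrict (X t)) Y ≤ ∑ i ∈ C, condEnt p (fun t => X t i) Y := by
  classical
  induction C using Finset.induction_on with
  | empty =>
    rw [Finset.sum_empty, condEnt, sub_nonpos]
    exact ent_mono hp fun t u h => Prod.ext (Subsingleton.elim _ _) h
  | insert i C hi ih =>
    rw [Finset.sum_insert hi]
    calc condEnt p (fun t => (insert i C).restrict (X t)) Y
        ≤ condEnt p (fun t => (X t i, C.restrict (X t))) Y := by
          refine condEnt_mono_left hp (fun t u h => funext fun ⟨n, hn⟩ => ?_) Y
          rw [Prod.mk.injEq] at h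
          rcases Finset.mem_insert.1 hn with rfl | hn
          · exact h.1
          · exact congrFun h.2 ⟨n, hn⟩
      _ ≤ condEnt p (fun t => X t i) Y + condEnt p (fun t => C.restrict (X t)) Y :=
          condEnt_prod_le hp _ _ Y
      _ ≤ _ := by gcongr

lemma condEnt_le_sum {ι : Type*} [Fintype ι] {π : ι → Type*} (hp : ∀ t, 0 ≤ p t)
    (X : T → ∀ i, π i) (Y : T → β) : condEnt p X Y ≤ ∑ i, condEnt p (fun t => X t i) Y :=
  (condEnt_mono_left hp (fun _ _ h => funext fun i => congrFun h ⟨i, Finset.mem_univ i⟩) Y).trans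
    (condEnt_restrict_le_sum hp Finset.univ X Y)

/-- Given `Y`, variables `X i` of entropy at most `c` that reach the largest possible joint
entropy are mutually independent. -/
lemma le_condEnt_apply_of_card_mul_le {ι : Type*} [Fintype ι] {π : ι → Type*}
    (hp : ∀ t, 0 ≤ p t) {X : T → ∀ i, π i} {Y : T → β} {c : ℝ}
    (hc : ∀ i, condEnt p (fun t => X t i) Y ≤ c) (h : Fintype.card ι * c ≤ condEnt p X Y)
    {i : ι} {U : Finset ι} (hi : i ∉ U) :
    c ≤ condEnt p (fun t => X t i) fun t => (U.restrict (X t), Y t) := by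
  classical
  have hsplit : condEnt p X Y ≤ condEnt p (fun t => X t i)
      (fun t => (({i}ᶜ : Finset ι).restrict (X t), Y t)) +
      condEnt p (fun t => ({i}ᶜ : Finset ι).restrict (X t)) Y := by
    rw [← condEnt_prod hp]
    refine condEnt_mono_left hp (fun t u htu => funext fun j => ?_) Y
    rw [Prod.mk.injEq] at htu
    by_cases hj : j = i
    · exact hj ▸ htu.1
    · exact congrFun htu.2 ⟨j, by simpa using hj⟩
  have hrest : condEnt p (fun t => ({i}ᶜ : Finset ι).restrict (X t)) Y ≤
      (Fintype.card ι - 1) * c := by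
    refine ((condEnt_restrict_le_sum hp _ X Y).trans (Finset.sum_le_card_nsmul _ _ c
      fun j _ => hc j)).trans_eq ?_
    rw [nsmul_eq_mul, Finset.card_compl, Finset.card_singleton,
      Nat.cast_pred (Fintype.card_pos_iff.2 ⟨i⟩)]
  refine le_trans (by linarith) (condEnt_anti_right hp (fun t => X t i)
    (Y' := fun t => (({i}ᶜ : Finset ι).restrict (X t), Y t)) fun t u htu => ?_)
  rw [Prod.mk.injEq] at htu
  refine Prod.ext (funext fun j => congrFun htu.1 ⟨j, ?_⟩) htu.2
  simpa using ne_of_mem_of_not_mem j.2 hi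

namespace EntIndep

variable {X : T → α} {Y : T → β}

lemma condEnt_eq (h : EntIndep p X Y) : condEnt p X Y = ent p X := by
  rw [condEnt, h, add_sub_cancel_right]

lemma symm (hp : ∀ t, 0 ≤ p t) (h : EntIndep p X Y) : EntIndep p Y X := by
  rw [EntIndep, add_comm, ← h, ent_congr hp]
  simp [and_comm]

lemma mono_right (hp : ∀ t, 0 ≤ p t) (h1 : ∑ t, p t = 1) (h : EntIndep p X Y) {Y' : T → γ}
    (hY : Y'.FactorsThrough Y) : EntIndep p X Y' := by
  have hle := condEnt_le_ent hp h1 X Y'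
  have hge := condEnt_anti_right hp X hY
  rw [h.condEnt_eq] at hge
  rw [condEnt] at hle hge
  rw [EntIndep]
  linarith

lemma mono_left (hp : ∀ t, 0 ≤ p t) (h1 : ∑ t, p t = 1) (h : EntIndep p X Y) {X' : T → γ}
    (hX : X'.FactorsThrough X) : EntIndep p X' Y :=
  ((h.symm hp).mono_right hp h1 hX).symm hp

lemma prod_right (hp : ∀ t, 0 ≤ p t) (h1 : ∑ t, p t = 1) {Z : T → γ} (h : EntIndep p X Y)
    (hZ : EntIndep p (fun t => (X t, Y t)) Z) : EntIndep p X fun t => (Y t, Z t) := by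
  have hYZ : EntIndep p Y Z := hZ.mono_left hp h1 fun _ _ htu => congrArg Prod.snd htu
  rw [EntIndep] at h hZ hYZ ⊢
  rw [ent_congr hp (g := fun t => ((X t, Y t), Z t)) (by simp [and_assoc])]
  linarith

lemma law_prod [Finite α] [Finite β] (hp : ∀ t, 0 ≤ p t) (h1 : ∑ t, p t = 1)
    (h : EntIndep p X Y) (x : α) (y : β) :
    law p (fun t => (X t, Y t)) (x, y) = law p X x * law p Y y := by
  cases nonempty_fintype α
  cases nonempty_fintype β
  have hprod := eq_of_sum_mul_log_sub_log_eq_zero (law_nonneg hp _)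
    (condProd_nonneg hp X Y fun _ => ()) (fun w => law_eq_zero_of_condProd_eq_zero hp)
    (by rw [sum_condProd, sum_law])
    (by
      rw [sum_law_mul_log_sub_log_condProd hp]
      simp only [condEnt_of_subsingleton hp h1]
      exact sub_eq_zero.2 (Eq.symm h))
  have hunit : law p (fun _ => ()) () = 1 := by simp [law, h1]
  have hx : law p (fun t => (X t, ())) (x, ()) = law p X x := law_congr (by ext; simp)
  have hy : law p (fun t => (Y t, ())) (y, ()) = law p Y y := law_congr (by ext; simp)
  rw [law_congr (g := fun t => ((X t, Y t), ())) (y := ((x, y), ())) (by ext; simp),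
    congrFun hprod, condProd, hx, hy, hunit, div_one]

/-- `A` is conditionally independent of `Q` given `V` and the part `Q'` of `Q`. -/
lemma condEnt_eq_condEnt (hp : ∀ t, 0 ≤ p t) (h1 : ∑ t, p t = 1) {Q : T → γ}
    (h : EntIndep p Y Q) {ε ζ : Type*} {A : T → δ} {V : T → ε} {Q' : T → ζ}
    (hV : V.FactorsThrough Y) (hQ : Q'.FactorsThrough Q)
    (hA : A.FactorsThrough fun t => (Y t, Q' t)) :
    condEnt p A (fun t => (V t, Q t)) = condEnt p A fun t => (V t, Q' t) := by
  refine le_antisymm (condEnt_anti_right hp A fun t u htu => ?_) ?_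
  · rw [Prod.mk.injEq] at htu
    rw [htu.1, hQ htu.2]
  have hVQ : EntIndep p V Q := h.mono_left hp h1 hV
  have hVQ' : EntIndep p V Q' := hVQ.mono_right hp h1 hQ
  have hYQ' : EntIndep p Y Q' := h.mono_right hp h1 hQ
  have hcond : condEnt p Q (fun t => (Y t, Q' t)) ≤ condEnt p Q fun t => (A t, V t, Q' t) :=
    condEnt_anti_right hp Q fun t u htu => by
      have hAtu := hA htu
      rw [Prod.mk.injEq] at htu
      simp only [hAtu, hV htu.1, htu.2]
  have hQYQ' : ent p (fun t => (Q t, Y t, Q' t)) = ent p fun t => (Y t, Q t) :=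
    ent_congr hp fun t u => by
      simp only [Prod.mk.injEq]
      exact ⟨fun h => ⟨h.2.1, h.1⟩, fun h => ⟨h.2, h.1, hQ h.2⟩⟩
  have hQAVQ' : ent p (fun t => (Q t, A t, V t, Q' t)) = ent p fun t => (A t, V t, Q t) :=
    ent_congr hp fun t u => by
      simp only [Prod.mk.injEq]
      exact ⟨fun h => ⟨h.2.1, h.2.2.1, h.1⟩, fun h => ⟨h.2.2, h.1, h.2.1, hQ h.2.2⟩⟩
  simp only [condEnt] at hcond ⊢
  simp only [EntIndep] at h hVQ hVQ' hYQ'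
  linarith

end EntIndep

end FiniteEntropy

lemma measureReal_preimage_comp {Ω T α : Type*} [MeasurableSpace Ω] (μ : Measure Ω)
    [IsFiniteMeasure μ] [Fintype T] {U : Ω → T} (hU : ∀ t, MeasurableSet (U ⁻¹' {t}))
    (f : T → α) (x : α) :
    μ.real ((f ∘ U) ⁻¹' {x}) = law (fun t => μ.real (U ⁻¹' {t})) f x := by
  classical
  have hfiber : (f ∘ U) ⁻¹' {x} = ⋃ t ∈ Finset.univ.filter (f · = x), U ⁻¹' {t} := by
    ext ω
    simp
  rw [hfiber, measureReal_biUnion_finset (fun t _ u _ htu => Set.disjoint_left.2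
    fun ω ht hu => htu (ht.symm.trans hu)) fun t _ => hU t, Finset.sum_filter]
  simp [law, Set.indicator_apply]

lemma entropy_nonneg {Ω α : Type*} [MeasurableSpace Ω] (μ : Measure Ω) [IsProbabilityMeasure μ]
    [Fintype α] {b : ℝ} (hb : 1 ≤ b) (X : Ω → α) : 0 ≤ entropy μ b X :=
  div_nonneg (Finset.sum_nonneg fun _ _ => Real.negMulLog_nonneg measureReal_nonneg
    measureReal_le_one) (Real.log_nonneg hb)

lemma entropy_comp {Ω T α : Type*} [MeasurableSpace Ω] (μ : Measure Ω) [IsFiniteMeasure μ]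
    [Fintype T] [Fintype α] {U : Ω → T} (hU : ∀ t, MeasurableSet (U ⁻¹' {t})) (b : ℝ)
    (f : T → α) :
    entropy μ b (f ∘ U) = ent (fun t => μ.real (U ⁻¹' {t})) f / Real.log b := by
  simp only [entropy, ent_eq_sum_negMulLog, measureReal_preimage_comp μ hU]

namespace Scheme

variable {N K : ℕ} (s : Scheme.{u} N K)

lemma one_lt_q : 1 < s.q := Nat.one_lt_cast.2 Fintype.one_lt_card

lemma log_q_pos : 0 < Real.log s.q := Real.log_pos s.one_lt_q

/-- A finite sample space that carries all variables of the scheme: the messages, the noise, the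
queries for every wanted message, and the wanted index. -/
abbrev Sample : Type u :=
  (Fin K → Fin s.L → s.F) × s.Noise × (Fin K → (n : Fin N) → s.Query n) × Fin K

/-- The outcome of the scheme in the finite sample space. -/
def sample (ω : s.Ω) : s.Sample := (s.W ω, s.Z ω, fun k => s.Q k ω, s.Θ ω)

/-- The mass function of the outcome of the scheme. -/
def mass (t : s.Sample) : ℝ := s.μ.real (s.sample ⁻¹' {t})

/-- The messages, as a variable on the finite sample space. -/
def messages (t : s.Sample) : Fin K → Fin s.L → s.F := t.1

/-- The contents of the servers, as a variable on the finite sample space. -/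
def storage (t : s.Sample) (n : Fin N) : Fin (s.storageLen n) → s.F := s.Ψ n t.1 t.2.1

/-- The queries for message `k`, as a variable on the finite sample space. -/
def query (k : Fin K) (t : s.Sample) : (n : Fin N) → s.Query n := t.2.2.1 k

/-- The wanted index, as a variable on the finite sample space. -/
def wanted (t : s.Sample) : Fin K := t.2.2.2

/-- The answers when message `k` is wanted, as a variable on the finite sample space. -/
def answers (k : Fin K) (t : s.Sample) (n : Fin N) : Fin (s.answerLen n) → s.F :=
  s.φ n (s.storage t n) (s.query k t n)

/-- The messages together with the contents of the servers. -/
def contents (t : s.Sample) :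
    (Fin K → Fin s.L → s.F) × ((n : Fin N) → Fin (s.storageLen n) → s.F) :=
  (s.messages t, s.storage t)

/-- The side information in the converse: the messages in `U` and the contents of the servers
in `C`. -/
def known (C : Finset (Fin N)) (U : Finset (Fin K)) (t : s.Sample) :
    (U → Fin s.L → s.F) × ((n : C) → Fin (s.storageLen n) → s.F) :=
  (U.restrict (s.messages t), C.restrict (s.storage t))

lemma measurableSet_sample (t : s.Sample) : MeasurableSet (s.sample ⁻¹' {t}) := by
  have h : s.sample ⁻¹' {t} = s.W ⁻¹' {t.1} ∩ (s.Z ⁻¹' {t.2.1} ∩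
      ((⋂ k, s.Q k ⁻¹' {t.2.2.1 k}) ∩ s.Θ ⁻¹' {t.2.2.2})) := by
    ext ω
    simp [sample, Prod.ext_iff, funext_iff]
  rw [h]
  exact (s.W_measurable trivial).inter ((s.Z_measurable trivial).inter
    ((MeasurableSet.iInter fun k => s.Q_measurable k trivial).inter (s.Θ_measurable trivial)))

lemma mass_nonneg (t : s.Sample) : 0 ≤ s.mass t := measureReal_nonneg

lemma measureReal_preimage_sample {α : Type*} (f : s.Sample → α) (x : α) :
    s.μ.real ((f ∘ s.sample) ⁻¹' {x}) = law s.mass f x :=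
  measureReal_preimage_comp s.μ s.measurableSet_sample f x

lemma entropy_sample {α : Type*} [Fintype α] (f : s.Sample → α) :
    entropy s.μ s.q (f ∘ s.sample) = ent s.mass f / Real.log s.q :=
  entropy_comp s.μ s.measurableSet_sample s.q f

lemma sum_mass : ∑ t, s.mass t = 1 := by
  rw [← sum_law fun _ => (), Fintype.sum_unique, ← measureReal_preimage_sample]
  simp [Function.comp_def]

lemma entIndep_of_mutualInfo {α β : Type*} [Fintype α] [Fintype β] {f : s.Sample → α}
    {g : s.Sample → β} (h : mutualInfo s.μ s.q (f ∘ s.sample) (g ∘ s.sample) = 0) :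
    EntIndep s.mass f g := by
  have hfg := s.entropy_sample fun t => (f t, g t)
  rw [mutualInfo, s.entropy_sample f, s.entropy_sample g, ← add_div, sub_eq_zero] at h
  exact (div_left_inj' s.log_q_pos.ne').1 (hfg.symm.trans h.symm)

lemma condEnt_eq_zero_of_condEntropy {α β : Type*} [Fintype α] [Fintype β] {f : s.Sample → α}
    {g : s.Sample → β} (h : condEntropy s.μ s.q (f ∘ s.sample) (g ∘ s.sample) = 0) :
    condEnt s.mass f g = 0 := by
  have hfg := s.entropy_sample fun t => (f t, g t)
  rw [condEntropy, s.entropy_sample g, sub_eq_zero] at h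
  exact sub_eq_zero.2 ((div_left_inj' s.log_q_pos.ne').1 (hfg.symm.trans h))

lemma ent_messages : ent s.mass s.messages = K * (s.L * Real.log s.q) := by
  have hcard : (Fintype.card (Fin K → Fin s.L → s.F) : ℝ) = s.q ^ (K * s.L) := by
    simp [q, ← pow_mul, mul_comm]
  rw [ent_of_uniform, hcard, Real.log_pow, Nat.cast_mul, mul_assoc]
  intro w
  rw [← s.measureReal_preimage_sample, hcard, ← one_div]
  exact s.W_uniform w

lemma ent_message_le (k : Fin K) :
    ent s.mass (fun t => s.messages t k) ≤ s.L * Real.log s.q :=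
  (ent_le_log_card s.mass_nonneg s.sum_mass _).trans_eq (by simp [q])

variable {s} {C : Finset (Fin N)} {U : Finset (Fin K)}

lemma NoPriorInfo.entIndep (h : s.NoPriorInfo) (k : Fin K) :
    EntIndep s.mass s.contents (s.query k) :=
  s.entIndep_of_mutualInfo (h k)

lemma IsSecure.entIndep {M : ℕ} {X : Fin M → Finset (Fin N)} (h : s.IsSecure X) (m : Fin M) :
    EntIndep s.mass s.messages fun t => (X m).restrict (s.storage t) :=
  s.entIndep_of_mutualInfo (h.2 m)

lemma IsDecodable.condEnt_eq_zero (h : s.IsDecodable) (k : Fin K) :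
    condEnt s.mass (fun t => s.messages t k) (fun t => (s.answers k t, s.query k t)) = 0 :=
  s.condEnt_eq_zero_of_condEntropy (h k)

lemma IsPrivate.law_query_eq (h : s.IsPrivate) (n : Fin N) (k k' : Fin K) :
    law s.mass (fun t => s.query k t n) = law s.mass fun t => s.query k' t n := by
  suffices hwanted : ∀ k x, law s.mass (fun t => s.query k t n) x =
      law s.mass (fun t => s.query (s.wanted t) t n) x from
    funext fun x => (hwanted k x).trans (hwanted k' x).symm
  intro k x
  have hpos : law s.mass s.wanted k ≠ 0 := by
    rw [← measureReal_preimage_sample]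
    exact (s.Θ_pos k).ne'
  have hfixed : EntIndep s.mass s.wanted fun t => s.query k t n :=
    (s.entIndep_of_mutualInfo (f := s.wanted) (g := s.query k) (s.Θ_indep k)).mono_right
      s.mass_nonneg s.sum_mass fun _ _ htu => congrFun htu n
  have hrandom : EntIndep s.mass s.wanted fun t => s.query (s.wanted t) t n :=
    s.entIndep_of_mutualInfo (h n)
  -- The fixed and the random query agree when message `k` is wanted.
  refine mul_left_cancel₀ hpos ?_
  rw [← hfixed.law_prod s.mass_nonneg s.sum_mass, ← hrandom.law_prod s.mass_nonneg s.sum_mass]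
  refine law_congr (Set.ext fun t => ?_)
  simp only [Set.mem_preimage, Set.mem_singleton_iff, Prod.mk.injEq]
  exact and_congr_right fun ht => by rw [ht]

lemma law_contents_query_eq (hN : s.NoPriorInfo) (hP : s.IsPrivate) (n : Fin N) (k k' : Fin K) :
    law s.mass (fun t => (s.contents t, s.query k t n)) =
      law s.mass fun t => (s.contents t, s.query k' t n) := by
  have hindep : ∀ k, EntIndep s.mass s.contents fun t => s.query k t n := fun k =>
    (hN.entIndep k).mono_right s.mass_nonneg s.sum_mass fun _ _ htu => congrFun htu n
  funext ⟨x, y⟩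
  rw [(hindep k).law_prod s.mass_nonneg s.sum_mass, hP.law_query_eq n k k',
    (hindep k').law_prod s.mass_nonneg s.sum_mass]

/-- Given its query, an answer is independent of the other queries, and by privacy the law of that
query does not depend on the wanted message. -/
lemma condEnt_answer_eq (hN : s.NoPriorInfo) (hP : s.IsPrivate) (n : Fin N) (k k' : Fin K)
    {α : Type*}
    (v : (Fin K → Fin s.L → s.F) × ((n : Fin N) → Fin (s.storageLen n) → s.F) → α) :
    condEnt s.mass (fun t => s.answers k t n) (fun t => (v (s.contents t), s.query k t)) =
      condEnt s.mass (fun t => s.answers k' t n) fun t => (v (s.contents t), s.query k' t) := by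
  have hlocal : ∀ k,
      condEnt s.mass (fun t => s.answers k t n) (fun t => (v (s.contents t), s.query k t)) =
        condEnt s.mass (fun t => s.answers k t n) fun t => (v (s.contents t), s.query k t n) :=
    fun k => (hN.entIndep k).condEnt_eq_condEnt s.mass_nonneg s.sum_mass
      (fun _ _ htu => congrArg v htu) (fun _ _ htu => congrFun htu n)
      fun t u htu => by
        rw [Prod.mk.injEq, contents, contents, Prod.mk.injEq] at htu
        simp only [answers, htu]
  have hlaw := law_contents_query_eq hN hP n k k'
  rw [hlocal, hlocal]
  exact congrArg₂ (· - ·)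
    (ent_comp_congr hlaw fun z => (s.φ n (z.1.2 n) z.2, v z.1, z.2))
    (ent_comp_congr hlaw fun z => (v z.1, z.2))

lemma le_condEnt_message (hN : s.NoPriorInfo)
    (hC : EntIndep s.mass s.messages fun t => C.restrict (s.storage t)) {k : Fin K} (hk : k ∉ U) :
    s.L * Real.log s.q ≤
      condEnt s.mass (fun t => s.messages t k) fun t => (s.known C U t, s.query k t) := by
  have hp := s.mass_nonneg
  have h1 := s.sum_mass
  have hindep : EntIndep s.mass s.messages fun t => (C.restrict (s.storage t), s.query k t) :=
    hC.prod_right hp h1 ((hN.entIndep k).mono_left hp h1 fun t u htu => by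
      rw [contents, contents, Prod.mk.injEq] at htu
      simp only [htu])
  refine (le_condEnt_apply_of_card_mul_le hp
    (fun i => (condEnt_le_ent hp h1 _ _).trans (s.ent_message_le i))
    (by rw [hindep.condEnt_eq, s.ent_messages, Fintype.card_fin]) hk).trans_eq
    (condEnt_congr hp (fun _ _ => Iff.rfl) ?_)
  simp [known, and_assoc]

lemma IsDecodable.condEnt_message_eq_zero (hD : s.IsDecodable) (k : Fin K) :
    condEnt s.mass (fun t => s.messages t k)
      (fun t => (Cᶜ.restrict (s.answers k t), s.known C U t, s.query k t)) = 0 := by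
  refine le_antisymm ?_ (condEnt_nonneg s.mass_nonneg _ _)
  rw [← hD.condEnt_eq_zero k]
  refine condEnt_anti_right s.mass_nonneg _ fun t u htu => ?_
  simp only [known, Prod.mk.injEq] at htu
  refine Prod.ext (funext fun n => ?_) htu.2.2
  by_cases hn : n ∈ C
  · have hstorage : s.storage t n = s.storage u n := congrFun htu.2.1.2 ⟨n, hn⟩
    simp only [answers, hstorage, htu.2.2]
  · exact congrFun htu.1 ⟨n, Finset.mem_compl.2 hn⟩

lemma add_condEnt_answers_insert_le (hN : s.NoPriorInfo) (hD : s.IsDecodable)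
    (hC : EntIndep s.mass s.messages fun t => C.restrict (s.storage t)) {k : Fin K} (hk : k ∉ U) :
    s.L * Real.log s.q + condEnt s.mass (fun t => Cᶜ.restrict (s.answers k t))
        (fun t => (s.known C (insert k U) t, s.query k t)) ≤
      condEnt s.mass (fun t => Cᶜ.restrict (s.answers k t))
        fun t => (s.known C U t, s.query k t) := by
  have hp := s.mass_nonneg
  set A := fun t => Cᶜ.restrict (s.answers k t)
  set Wk := fun t => s.messages t k
  set V := fun t => (s.known C U t, s.query k t)
  have hW : s.L * Real.log s.q ≤ condEnt s.mass Wk V := le_condEnt_message hN hC hk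
  have hA : condEnt s.mass A (fun t => (s.known C (insert k U) t, s.query k t)) ≤
      condEnt s.mass A fun t => (Wk t, V t) := by
    refine condEnt_anti_right hp A fun t u htu => ?_
    simp only [known, Prod.mk.injEq, funext_iff, Subtype.forall] at htu
    simp only [Wk, V, known, Prod.mk.injEq, funext_iff, Subtype.forall]
    exact ⟨htu.1.1 k (Finset.mem_insert_self k U),
      ⟨fun i hi => htu.1.1 i (Finset.mem_insert_of_mem hi), htu.1.2⟩, htu.2⟩
  calc s.L * Real.log s.q + condEnt s.mass A (fun t => (s.known C (insert k U) t, s.query k t))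
      ≤ condEnt s.mass A (fun t => (Wk t, V t)) + condEnt s.mass Wk V := by linarith
    _ = condEnt s.mass (fun t => (A t, Wk t)) V := (condEnt_prod hp A Wk V).symm
    _ = condEnt s.mass (fun t => (Wk t, A t)) V :=
        condEnt_congr hp (by simp [and_comm]) fun _ _ => Iff.rfl
    _ = condEnt s.mass A V := by
        rw [condEnt_prod hp, hD.condEnt_message_eq_zero k, zero_add]

lemma condEnt_answers_le_card_mul (hN : s.NoPriorInfo) (hP : s.IsPrivate) (D : Finset (Fin N))
    (k k' : Fin K) :
    condEnt s.mass (fun t => D.restrict (s.answers k' t))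
        (fun t => (s.known C U t, s.query k' t)) ≤
      #D * condEnt s.mass (fun t => D.restrict (s.answers k t))
        fun t => (s.known C U t, s.query k t) := by
  rw [← nsmul_eq_mul]
  refine (condEnt_restrict_le_sum s.mass_nonneg D _ _).trans
    (Finset.sum_le_card_nsmul _ _ _ fun n hn => ?_)
  exact (condEnt_answer_eq hN hP n k' k fun c => (U.restrict c.1, C.restrict c.2)).trans_le
    (condEnt_mono_left s.mass_nonneg (fun _ _ htu => congrFun htu ⟨n, hn⟩) _)

lemma mul_geom_sum_le_condEnt_answers (hN : s.NoPriorInfo) (hP : s.IsPrivate)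
    (hD : s.IsDecodable) (hC : EntIndep s.mass s.messages fun t => C.restrict (s.storage t))
    {m : ℕ} {k : Fin K} (hk : k ∉ U) (hm : m ≤ #Uᶜ) :
    s.L * Real.log s.q * ∑ i ∈ Finset.range m, (#Cᶜ : ℝ)⁻¹ ^ i ≤
      condEnt s.mass (fun t => Cᶜ.restrict (s.answers k t))
        fun t => (s.known C U t, s.query k t) := by
  induction m generalizing U k with
  | zero => simpa using condEnt_nonneg s.mass_nonneg _ _
  | succ m ih =>
    refine le_trans ?_ (add_condEnt_answers_insert_le hN hD hC hk)
    rw [geom_sum_succ, mul_add, mul_one, add_comm, mul_left_comm]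
    gcongr
    have hm' : m ≤ #(insert k U)ᶜ := by
      rw [Finset.card_compl, Finset.card_insert_of_notMem hk]
      rw [Finset.card_compl] at hm
      omega
    rcases m.eq_zero_or_pos with rfl | hpos
    · simpa using condEnt_nonneg s.mass_nonneg _ _
    obtain ⟨k', hk'⟩ := Finset.card_pos.1 (hpos.trans_le hm')
    exact inv_mul_le_of_le_mul₀ (Nat.cast_nonneg _) (condEnt_nonneg s.mass_nonneg _ _)
      ((ih (Finset.mem_compl.1 hk') hm').trans (condEnt_answers_le_card_mul hN hP Cᶜ k k'))

lemma mul_geom_sum_le_sum_entropy_answer (hN : s.NoPriorInfo) (hP : s.IsPrivate)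
    (hD : s.IsDecodable) (hC : EntIndep s.mass s.messages fun t => C.restrict (s.storage t))
    (k : Fin K) :
    s.L * ∑ i ∈ Finset.range K, (#Cᶜ : ℝ)⁻¹ ^ i ≤ ∑ n ∈ Cᶜ, entropy s.μ s.q (s.A k n) := by
  have hent : ∀ n, entropy s.μ s.q (s.A k n) =
      ent s.mass (fun t => s.answers k t n) / Real.log s.q :=
    fun n => s.entropy_sample fun t => s.answers k t n
  have h := (mul_geom_sum_le_condEnt_answers hN hP hD hC (Finset.notMem_empty k) (m := K)
    (by simp)).trans (condEnt_restrict_le_sum s.mass_nonneg Cᶜ _ _)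
  simp only [hent, ← Finset.sum_div]
  rw [le_div_iff₀ s.log_q_pos, mul_right_comm]
  exact h.trans (Finset.sum_le_sum fun n _ => condEnt_le_ent s.mass_nonneg s.sum_mass _ _)

lemma condEnt_messages_storage (hN : s.NoPriorInfo) (hD : s.IsDecodable) :
    condEnt s.mass s.messages s.storage = 0 := by
  have hp := s.mass_nonneg
  refine le_antisymm ((condEnt_le_sum hp _ _).trans (Finset.sum_nonpos fun k _ => ?_))
    (condEnt_nonneg hp _ _)
  calc condEnt s.mass (fun t => s.messages t k) s.storage
      = condEnt s.mass (fun t => s.messages t k) fun t => (s.storage t, ()) :=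
        condEnt_congr hp (fun _ _ => Iff.rfl) (by simp)
    _ = condEnt s.mass (fun t => s.messages t k) fun t => (s.storage t, s.query k t) :=
        ((hN.entIndep k).condEnt_eq_condEnt hp s.sum_mass (fun _ _ htu => congrArg Prod.snd htu)
          (fun _ _ _ => rfl) fun _ _ htu => congrArg (fun z => z.1.1 k) htu).symm
    _ ≤ condEnt s.mass (fun t => s.messages t k) fun t => (s.answers k t, s.query k t) :=
        condEnt_anti_right hp _ fun t u htu => by
          rw [Prod.mk.injEq] at htu
          simp only [answers, funext_iff, Prod.mk.injEq, htu, implies_true, and_self]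
    _ = 0 := hD.condEnt_eq_zero k

lemma mul_le_sum_entropy_storage (hN : s.NoPriorInfo) (hD : s.IsDecodable)
    (hC : EntIndep s.mass s.messages fun t => C.restrict (s.storage t)) :
    (K * s.L : ℝ) ≤ ∑ n ∈ Cᶜ, entropy s.μ s.q (s.S n) := by
  have hp := s.mass_nonneg
  have hent : ∀ n, entropy s.μ s.q (s.S n) =
      ent s.mass (fun t => s.storage t n) / Real.log s.q :=
    fun n => s.entropy_sample fun t => s.storage t n
  set SC := fun t => C.restrict (s.storage t)
  set SD := fun t => Cᶜ.restrict (s.storage t)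
  have hzero : condEnt s.mass s.messages (fun t => (SD t, SC t)) ≤ 0 := by
    rw [← condEnt_messages_storage hN hD]
    refine condEnt_anti_right hp _ fun t u htu => funext fun n => ?_
    rw [Prod.mk.injEq] at htu
    by_cases hn : n ∈ C
    · exact congrFun htu.2 ⟨n, hn⟩
    · exact congrFun htu.1 ⟨n, Finset.mem_compl.2 hn⟩
  simp only [hent, ← Finset.sum_div]
  rw [le_div_iff₀ s.log_q_pos]
  calc K * s.L * Real.log s.q = condEnt s.mass s.messages SC := by
        rw [hC.condEnt_eq, s.ent_messages, mul_assoc]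
    _ ≤ condEnt s.mass (fun t => (s.messages t, SD t)) SC :=
        condEnt_mono_left hp (X' := fun t => (s.messages t, SD t))
          (fun _ _ htu => (Prod.ext_iff.1 htu).1) SC
    _ ≤ condEnt s.mass SD SC := by
        rw [condEnt_prod hp]
        exact add_le_of_nonpos_left hzero
    _ ≤ ∑ n ∈ Cᶜ, condEnt s.mass (fun t => s.storage t n) SC := condEnt_restrict_le_sum hp Cᶜ _ _
    _ ≤ ∑ n ∈ Cᶜ, ent s.mass fun t => s.storage t n :=
        Finset.sum_le_sum fun n _ => condEnt_le_ent hp s.sum_mass _ _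

lemma mul_avgStorage :
    N * s.avgStorage = (∑ n, entropy s.μ s.q (s.S n)) / (K * s.L) := by
  rcases N.eq_zero_or_pos with rfl | hN
  · simp
  · rw [avgStorage, mul_assoc, mul_div_assoc', mul_div_mul_left _ _ (by positivity)]

lemma mul_avgDownload (k : Fin K) :
    N * s.avgDownload k = (∑ n, entropy s.μ s.q (s.A k n)) / s.L := by
  rcases N.eq_zero_or_pos with rfl | hN
  · simp
  · rw [avgDownload, mul_one_div, div_mul_cancel_left₀ (by positivity), rate, inv_div]

end Scheme

lemma sum_sum_compl_le_mul_sum {M N d : ℕ} {X : Fin M → Finset (Fin N)}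
    (hd : ∀ n, #{m | n ∉ X m} ≤ d) {f : Fin N → ℝ} (hf : ∀ n, 0 ≤ f n) :
    ∑ m, ∑ n ∈ (X m)ᶜ, f n ≤ d * ∑ n, f n := by
  rw [Finset.sum_comm' (t' := Finset.univ) (s' := fun n => Finset.univ.filter (n ∉ X ·))
    (by simp), Finset.mul_sum]
  refine Finset.sum_le_sum fun n _ => ?_
  rw [Finset.sum_const, nsmul_eq_mul]
  exact mul_le_mul_of_nonneg_right (Nat.cast_le.2 (hd n)) (hf n)

lemma card_filter_notMem_compl_pair {α : Type*} [Fintype α] [DecidableEq α] (A : Finset α)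
    (n : α) : #{m | n ∉ ![A, Aᶜ] m} = 1 := by
  by_cases hn : n ∈ A <;> simp [Finset.card_filter, Fin.sum_univ_two, hn]

lemma pair_eq_compl_pair {i j k l : Fin 4} (hij : i ≠ j) (hik : i ≠ k) (hil : i ≠ l)
    (hjk : j ≠ k) (hjl : j ≠ l) (hkl : k ≠ l) : ({k, l} : Finset (Fin 4)) = {i, j}ᶜ := by
  decide +revert

end AXPIR

theorem theorem1_general {N K M d : ℕ} {X : Fin M → Finset (Fin N)}
    (hd : ∀ n, #{m | n ∉ X m} ≤ d) {α β : ℝ}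
    (h : (α, β) ∈ AXPIR.region.{u} N K X) :
    (M : ℝ) ≤ d * (N * α) ∧
      ∑ m, ∑ t ∈ Finset.range K, (#(X m)ᶜ : ℝ)⁻¹ ^ t ≤ d * (N * β) := by
  obtain ⟨s, k, hN, hP, hS, hD, hαβ⟩ := h
  obtain ⟨rfl, rfl⟩ := Prod.mk.inj hαβ
  have hL : (0 : ℝ) < s.L := Nat.cast_pos.2 s.L_pos
  have hKL : (0 : ℝ) < K * s.L := mul_pos (Nat.cast_pos.2 k.pos) hL
  have hstorage := Finset.sum_le_sum fun m (_ : m ∈ Finset.univ) =>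
    AXPIR.Scheme.mul_le_sum_entropy_storage hN hD (hS.entIndep m)
  have hdownload := Finset.sum_le_sum fun m (_ : m ∈ Finset.univ) =>
    AXPIR.Scheme.mul_geom_sum_le_sum_entropy_answer hN hP hD (hS.entIndep m) k
  rw [AXPIR.Scheme.mul_avgStorage, AXPIR.Scheme.mul_avgDownload, mul_div_assoc', mul_div_assoc',
    le_div_iff₀ hKL, le_div_iff₀ hL]
  constructor
  · simpa using hstorage.trans (AXPIR.sum_sum_compl_le_mul_sum hd fun _ =>
      AXPIR.entropy_nonneg _ s.one_lt_q.le _)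
  · rw [mul_comm, Finset.mul_sum]
    exact hdownload.trans (AXPIR.sum_sum_compl_le_mul_sum hd fun _ =>
      AXPIR.entropy_nonneg _ s.one_lt_q.le _)

end

theorem theorem1 (i j k l : Fin 4) (hij : i ≠ j) (hik : i ≠ k) (hil : i ≠ l)
    (hjk : j ≠ k) (hjl : j ≠ l) (hkl : k ≠ l) (α β : ℝ)
    (h : (α, β) ∈ AXPIR.region.{u} 4 2 ![{i, j}, {k, l}]) :
    3 / 4 ≤ β ∧ 2 ≤ α + 2 * β ∧ 3 ≤ α + 6 * β := by
  rw [AXPIR.pair_eq_compl_pair hij hik hil hjk hjl hkl] at h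
  have hcard : ({i, j} : Finset (Fin 4)).card = 2 := Finset.card_pair hij
  have hcard' : ({i, j}ᶜ : Finset (Fin 4)).card = 2 := by
    rw [Finset.card_compl, hcard, Fintype.card_fin]
  obtain ⟨hα, hβ⟩ := theorem1_general
    (fun n => (AXPIR.card_filter_notMem_compl_pair {i, j} n).le) h
  simp only [Fin.sum_univ_two, Matrix.cons_val_zero, Matrix.cons_val_one, compl_compl, hcard,
    hcard', Finset.sum_range_succ, Finset.sum_range_zero] at hβ
  norm_num at hα hβ
  refine ⟨?_, ?_, ?_⟩ <;> linarith
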